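/- Let $n\ge 1$ be an integer. A polyhedron in $\mathbb R^n$ is the solution set of a finite system of inequalities $Ax\le b$; a face of a polyhedron $P$ is a set $P\cap\{x : a^\top x=c\}$ where $a^\top x\le c$ is valid on $P$ (so $\emptyset$ and $P$ are faces). A polyhedral complex is a collection of polyhedra that contains every face of each of its members and in which the intersection of any two members is a common face of both. A function $f:\mathbb R^n\to\mathbb R$ is piecewise linear if there is a finite polyhedral complex covering $\mathbb R^n$ such that $f$ is affine on the relative interior of each polyhedron of the complex; $\mathrm{PWL}_n$ is the class of all (possibly discontinuous) piecewise linear functions and $\mathrm{CPWL}_n$ the class of the continuous ones. For $k\ge 0$, let $\mathrm{ReLU}_n(k)$ be the class of functions $\mathbb R^n\to\mathbb R$ of the form $T_{k+1}\circ\sigma\circ T_k\circ\cdots\circ T_2\circ\sigma\circ T_1$, where $\sigma(t)=\max\{0,t\}$ is applied coordinatewise and $T_i:\mathbb R^{w_{i-1}}\to\mathbb R^{w_i}$ are affine maps with $w_0=n$, $w_{k+1}=1$ and arbitrary widths $w_1,\dots,w_k\in\mathbb N$. Let $\mathrm{SLT}_n(k)$ (shortcut linear threshold networks with $k$ hidden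 layers) be the class of functions $x\mapsto\langle A^\top x+b,\,x^{(k)}\rangle$, where $x^{(k)}=(\tau\circ T_k\circ\cdots\circ\tau\circ T_1)(x)\in\mathbb R^{w_k}$ with affine maps $T_i$ as above, $\tau$ is the threshold function ($\tau(t)=1$ if $t>0$ and $\tau(t)=0$ otherwise) applied coordinatewise, $A\in\mathbb R^{n\times w_k}$ and $b\in\mathbb R^{w_k}$. Theorem. For every integer $n\ge 1$, $$\mathrm{ReLU}_n(\lceil\log_2(n+1)\rceil)=\mathrm{CPWL}_n\subsetneq\mathrm{PWL}_n=\mathrm{SLT}_n(2).$$ In particular, shortcut linear threshold networks with 2 hidden layers represent exactly the (possibly discontinuous) piecewise linear functions. -/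

import Mathlib

open scoped Matrix

/-! Piecewise linear functions. The space `ℝⁿ` is `Fin n → ℝ`; only its affine structure and its
(usual) topology play a role. -/

/-- A polyhedron in `ℝⁿ`: the solution set of finitely many (possibly zero) weak linear
inequalities `A x ≤ b`. The empty set and `ℝⁿ` are polyhedra. -/
def IsPolyhedron {n : ℕ} (P : Set (Fin n → ℝ)) : Prop :=
  ∃ (m : ℕ) (A : Matrix (Fin m) (Fin n) ℝ) (b : Fin m → ℝ), P = {x | A *ᵥ x ≤ b}

/-- `F` is a face of `P`: `F = P ∩ {x | a ⬝ᵥ x = c}` for an inequality `a ⬝ᵥ x ≤ c` that is valid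
on `P`. The choices `a = 0`, `c = 0` and `a = 0`, `c = 1` give the faces `P` and `∅`. -/
def IsFaceOf {n : ℕ} (F P : Set (Fin n → ℝ)) : Prop :=
  ∃ (a : Fin n → ℝ) (c : ℝ), (∀ x ∈ P, a ⬝ᵥ x ≤ c) ∧ F = {x ∈ P | a ⬝ᵥ x = c}

/-- A polyhedral complex in `ℝⁿ`: a collection of polyhedra that is closed under taking faces and
in which any two members intersect in a common face. -/
structure IsPolyhedralComplex {n : ℕ} (K : Set (Set (Fin n → ℝ))) : Prop where
  isPolyhedron : ∀ P ∈ K, IsPolyhedron P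
  inter_isFaceOf : ∀ P ∈ K, ∀ Q ∈ K, IsFaceOf (P ∩ Q) P ∧ IsFaceOf (P ∩ Q) Q
  face_mem : ∀ P ∈ K, ∀ F, IsFaceOf F P → F ∈ K

/-- The class of (possibly discontinuous) piecewise linear functions `ℝⁿ → ℝ`: there is a finite
polyhedral complex covering `ℝⁿ` such that the function is affine on the relative interior
(`intrinsicInterior`) of each polyhedron of the complex. -/
def PWL (n : ℕ) : Set ((Fin n → ℝ) → ℝ) :=
  {f | ∃ K : Set (Set (Fin n → ℝ)), K.Finite ∧ IsPolyhedralComplex K ∧ ⋃₀ K = Set.univ ∧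
    ∀ P ∈ K, ∃ g : (Fin n → ℝ) →ᵃ[ℝ] ℝ, Set.EqOn f g (intrinsicInterior ℝ P)}

/-- The class of continuous piecewise linear functions `ℝⁿ → ℝ`. -/
def CPWL (n : ℕ) : Set ((Fin n → ℝ) → ℝ) :=
  {f | f ∈ PWL n ∧ Continuous f}

/-! Neural networks. -/

/-- The hidden part of a neural network: `HiddenLayers n k w` is a chain of affine maps
`T₁ : ℝ^{w₀} → ℝ^{w₁}`, …, `T_k : ℝ^{w_{k-1}} → ℝ^{w_k}` with `w₀ = n`, `w_k = w` and arbitrary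
widths in between. -/
inductive HiddenLayers (n : ℕ) : ℕ → ℕ → Type
  | input : HiddenLayers n 0 n
  | layer {k w w' : ℕ} (H : HiddenLayers n k w) (T : (Fin w → ℝ) →ᵃ[ℝ] (Fin w' → ℝ)) :
      HiddenLayers n (k + 1) w'

/-- The output `x⁽ᵏ⁾ = (σ ∘ T_k ∘ ⋯ ∘ σ ∘ T₁) x` of the last hidden layer, where the activation
function `σ` is applied coordinatewise. -/
def HiddenLayers.eval (σ : ℝ → ℝ) {n : ℕ} :
    {k w : ℕ} → HiddenLayers n k w → (Fin n → ℝ) → (Fin w → ℝ)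
  | _, _, .input, x => x
  | _, _, .layer H T, x => fun j => σ (T (H.eval σ x) j)

/-- A neural network `ℝⁿ → ℝᵐ` with `k` hidden layers: hidden layers followed by one more affine
map `T_{k+1}`. -/
structure NeuralNetwork (n k m : ℕ) where
  width : ℕ
  hidden : HiddenLayers n k width
  output : (Fin width → ℝ) →ᵃ[ℝ] (Fin m → ℝ)

/-- The function `T_{k+1} ∘ σ ∘ T_k ∘ ⋯ ∘ σ ∘ T₁` computed by a network with activation `σ`. -/
def NeuralNetwork.eval (σ : ℝ → ℝ) {n k m : ℕ} (N : NeuralNetwork n k m) (x : Fin n → ℝ) :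
    Fin m → ℝ :=
  N.output (N.hidden.eval σ x)

/-- The rectified linear unit. -/
noncomputable def reluActivation (t : ℝ) : ℝ := max 0 t

/-- The threshold activation: the indicator function of the positive reals. -/
noncomputable def thresholdActivation (t : ℝ) : ℝ := if 0 < t then 1 else 0

/-- The functions `ℝⁿ → ℝ` represented by ReLU networks with `k` hidden layers. -/
def ReLUClass (n k : ℕ) : Set ((Fin n → ℝ) → ℝ) :=
  {f | ∃ N : NeuralNetwork n k 1, ∀ x, f x = N.eval reluActivation x 0}

/-- A shortcut network `ℝⁿ → ℝ` with `k` hidden layers: hidden layers together with the matrix `A`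
and the vector `b` of the shortcut connection. -/
structure ShortcutNetwork (n k : ℕ) where
  width : ℕ
  hidden : HiddenLayers n k width
  A : Matrix (Fin n) (Fin width) ℝ
  b : Fin width → ℝ

/-- The output `⟨Aᵀ x + b, x⁽ᵏ⁾⟩` of a shortcut linear threshold network, where `x⁽ᵏ⁾` is the output
of the last hidden layer with threshold activations. -/
noncomputable def ShortcutNetwork.eval {n k : ℕ} (N : ShortcutNetwork n k) (x : Fin n → ℝ) : ℝ :=
  (N.Aᵀ *ᵥ x + N.b) ⬝ᵥ N.hidden.eval thresholdActivation x

/-- The functions `ℝⁿ → ℝ` represented by shortcut linear threshold networks with `k` hidden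
layers. -/
def SLTClass (n k : ℕ) : Set ((Fin n → ℝ) → ℝ) :=
  {f | ∃ N : ShortcutNetwork n k, ∀ x, f x = N.eval x}

/-!
A piecewise linear function is the same as a function that is affine on every cell of some
hyperplane arrangement: in the arrangement given by the inequalities of a complex, all points of a
cell lie in the relative interior of the same minimal polyhedron of the complex, while conversely
the closed cells of an arrangement form a complex. Sums, products with a threshold of another such
function, and hence the operations of both kinds of networks preserve this property.

A continuous piecewise linear `f` picks its values among finitely many affine functions `g`. Along
the segment from `a` to `b`, one of them satisfies `g a ≤ f a` and `f b ≤ g b`, so `f` is a lattice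
polynomial in affine functions: `f a = max_b min {g a | f b ≤ g b}`. It is therefore a difference of
maxima of affine functions. By Radon's theorem applied to their linear parts, more than `n + 1`
affine functions split into two parts such that everywhere some member of the first part is at most
some member of the second part `T`. Then the alternating sum of the maxima over `T ∪ S`, where `S`
runs through the subsets of the first part, vanishes, which expresses the maximum of all of them
through maxima of fewer. Finally, the maximum of `n + 1` affine functions is computed by a binary
tree of depth `⌈log₂ (n + 1)⌉`, each level of which costs one layer, since
`max f g = f + max 0 (g - f)`.

For threshold networks, the first layer determines on which side of each hyperplane a point lies,
and the second recognises a given sign vector by thresholding the number of mismatches. The shortcut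
connection then selects the affine function that belongs to the cell.
-/

section RelativeInterior

variable {E : Type*} [AddCommGroup E] [Module ℝ E] [TopologicalSpace E]

theorem exists_lineMap_mem_of_mem_intrinsicInterior [IsTopologicalAddGroup E]
    [ContinuousSMul ℝ E] {P : Set E} {x z : E} (hx : x ∈ intrinsicInterior ℝ P) (hz : z ∈ P) :
    ∃ t : ℝ, 1 < t ∧ AffineMap.lineMap z x t ∈ P := by
  obtain ⟨y, hy, rfl⟩ := mem_intrinsicInterior.1 hx
  let line : ℝ → affineSpan ℝ P := fun t =>
    ⟨AffineMap.lineMap z (y : E) t, AffineMap.lineMap_mem t (subset_affineSpan ℝ P hz) y.2⟩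
  have hline : Continuous line := AffineMap.lineMap_continuous.subtype_mk _
  have hone : line 1 = y := Subtype.ext (AffineMap.lineMap_apply_one z (y : E))
  have hnear : ∀ᶠ t in nhds 1, line t ∈ interior ((↑) ⁻¹' P) :=
    hline.continuousAt.eventually_mem (isOpen_interior.mem_nhds (hone ▸ hy))
  obtain ⟨t, htP, ht⟩ :=
    ((hnear.filter_mono nhdsWithin_le_nhds).and (self_mem_nhdsWithin (s := Set.Ioi 1))).exists
  exact ⟨t, ht, interior_subset (s := ((↑) ⁻¹' P : Set (affineSpan ℝ P))) htP⟩

theorem affineMap_eq_of_isMaxOn [IsTopologicalAddGroup E] [ContinuousSMul ℝ E] {P : Set E}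
    {φ : E →ᵃ[ℝ] ℝ} {x y : E} (hφ : IsMaxOn φ P x) (hx : x ∈ intrinsicInterior ℝ P)
    (hy : y ∈ P) : φ y = φ x := by
  obtain ⟨t, ht, htP⟩ := exists_lineMap_mem_of_mem_intrinsicInterior hx hy
  have hyx : φ y ≤ φ x := hφ hy
  have htx : φ (AffineMap.lineMap y x t) ≤ φ x := hφ htP
  rw [AffineMap.apply_lineMap, AffineMap.lineMap_apply_ring'] at htx
  nlinarith

end RelativeInterior

theorem mem_intrinsicInterior_of_forall_eq_zero {E : Type*} [NormedAddCommGroup E]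
    [NormedSpace ℝ E] [FiniteDimensional ℝ E] {L : Finset (E →ᵃ[ℝ] ℝ)} {x : E}
    (hx : ∀ ℓ ∈ L, ℓ x ≤ 0)
    (h : ∀ ℓ ∈ L, ℓ x = 0 → ∀ y, (∀ ℓ' ∈ L, ℓ' y ≤ 0) → ℓ y = 0) :
    x ∈ intrinsicInterior ℝ {y | ∀ ℓ ∈ L, ℓ y ≤ 0} := by
  set P : Set E := {y | ∀ ℓ ∈ L, ℓ y ≤ 0}
  refine mem_intrinsicInterior.2 ⟨⟨x, subset_affineSpan ℝ P hx⟩, ?_, rfl⟩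
  have hnear : ∀ ℓ ∈ L, ∀ᶠ y : affineSpan ℝ P in nhds ⟨x, subset_affineSpan ℝ P hx⟩, ℓ y ≤ 0 := by
    intro ℓ hℓ
    rcases (hx ℓ hℓ).lt_or_eq with hneg | hzero
    · have hcont : Continuous fun y : affineSpan ℝ P => ℓ y :=
        ℓ.continuous_of_finiteDimensional.comp continuous_subtype_val
      exact (hcont.continuousAt.eventually_lt continuousAt_const hneg).mono fun y hy => hy.le
    · have hspan : affineSpan ℝ P ≤ (affineSpan ℝ {(0 : ℝ)}).comap ℓ :=
        affineSpan_le.2 fun y hy => by simpa using h ℓ hℓ hzero y hy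
      exact .of_forall fun y => ((AffineSubspace.mem_affineSpan_singleton ℝ ℝ).1 (hspan y.2)).le
  exact mem_interior_iff_mem_nhds.2 (L.eventually_all.2 hnear)

section SignVectors

variable {E : Type*} [AddCommGroup E] [Module ℝ E]

/-- The signs of the affine maps in `L` at the point `x`. Its fibres are the cells of the
hyperplane arrangement of `L`. -/
noncomputable def signVector (L : Finset (E →ᵃ[ℝ] ℝ)) (x : E) (ℓ : L) : SignType :=
  SignType.sign (ℓ.1 x)

/-- The points satisfying all inequalities `ℓ ≤ 0`, `ℓ ∈ L`, that hold at `x₀`. If `L` is stable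
under negation, this is the closure of the cell of `x₀` in the hyperplane arrangement of `L`. -/
def closedCell (L : Finset (E →ᵃ[ℝ] ℝ)) (x₀ : E) : Set E :=
  {x | ∀ ℓ ∈ L, ℓ x₀ ≤ 0 → ℓ x ≤ 0}

variable {L M : Finset (E →ᵃ[ℝ] ℝ)} {x y : E}

theorem signVector_eq_iff :
    signVector L x = signVector L y ↔ ∀ ℓ ∈ L, SignType.sign (ℓ x) = SignType.sign (ℓ y) := by
  simp [signVector, funext_iff]

theorem signVector_eq_of_subset (hLM : L ⊆ M) (h : signVector M x = signVector M y) :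
    signVector L x = signVector L y :=
  signVector_eq_iff.2 fun ℓ hℓ => signVector_eq_iff.1 h ℓ (hLM hℓ)

theorem apply_nonpos_iff_of_signVector_eq (h : signVector L x = signVector L y) {ℓ : E →ᵃ[ℝ] ℝ}
    (hℓ : ℓ ∈ L) : ℓ x ≤ 0 ↔ ℓ y ≤ 0 := by
  rw [← sign_nonpos_iff, signVector_eq_iff.1 h ℓ hℓ, sign_nonpos_iff]

theorem self_mem_closedCell (x : E) : x ∈ closedCell L x := fun _ _ h => h

theorem closedCell_subset_of_mem (h : y ∈ closedCell L x) : closedCell L y ⊆ closedCell L x :=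
  fun _ hz ℓ hℓ hx => hz ℓ hℓ (h ℓ hℓ hx)

theorem convex_closedCell (x : E) : Convex ℝ (closedCell L x) := by
  have hcell : closedCell L x = ⋂ ℓ ∈ L, ⋂ _ : ℓ x ≤ 0, ℓ ⁻¹' Set.Iic 0 := by
    ext
    simp [closedCell]
  rw [hcell]
  exact convex_iInter₂ fun ℓ _ => convex_iInter fun _ => (convex_Iic 0).affine_preimage ℓ

theorem finite_range_closedCell : (Set.range (closedCell L)).Finite := by
  have hfactors : (closedCell L).FactorsThrough (signVector L) := fun x y hxy => by
    ext z
    exact forall₂_congr fun ℓ hℓ =>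
      imp_congr_left (apply_nonpos_iff_of_signVector_eq hxy hℓ)
  refine (Set.finite_range (Function.extend (signVector L) (closedCell L) fun _ => ∅)).subset ?_
  rintro _ ⟨x, rfl⟩
  exact ⟨signVector L x, hfactors.extend_apply _ x⟩

theorem signVector_eq_of_mem_closedCell (hL : ∀ ℓ ∈ L, -ℓ ∈ L) (hxy : x ∈ closedCell L y)
    (hyx : y ∈ closedCell L x) : signVector L x = signVector L y := by
  have hnonpos : ∀ ℓ ∈ L, ℓ x ≤ 0 ↔ ℓ y ≤ 0 := fun ℓ hℓ => ⟨hyx ℓ hℓ, hxy ℓ hℓ⟩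
  refine signVector_eq_iff.2 fun ℓ hℓ => ?_
  have hpos := hnonpos ℓ hℓ
  have hneg : 0 ≤ ℓ x ↔ 0 ≤ ℓ y := by simpa using hnonpos (-ℓ) (hL ℓ hℓ)
  simp only [sign_apply, ← not_le, hpos, hneg]

theorem subset_closedCell_of_mem_intrinsicInterior [TopologicalSpace E] [IsTopologicalAddGroup E]
    [ContinuousSMul ℝ E] (hL : ∀ ℓ ∈ L, -ℓ ∈ L) {C : Set E} (hC : C ⊆ closedCell L x)
    (hy : y ∈ intrinsicInterior ℝ C) : C ⊆ closedCell L y := by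
  intro z hz ℓ hℓ hℓy
  rcases le_or_gt (ℓ x) 0 with hℓx | hℓx
  · exact hC hz ℓ hℓ hℓx
  have hnonneg : ∀ w ∈ C, 0 ≤ ℓ w := fun w hw => by
    simpa using hC hw (-ℓ) (hL ℓ hℓ) (by simpa using hℓx.le)
  have hmax : IsMaxOn (-ℓ) C y := fun w hw => by
    simpa using hℓy.trans (hnonneg w hw)
  have hzy : (-ℓ) z = (-ℓ) y := affineMap_eq_of_isMaxOn hmax hy hz
  exact (neg_injective hzy).le.trans hℓy

theorem signVector_eq_of_mem_intrinsicInterior_closedCell [TopologicalSpace E]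
    [IsTopologicalAddGroup E] [ContinuousSMul ℝ E] (hL : ∀ ℓ ∈ L, -ℓ ∈ L)
    (hy : y ∈ intrinsicInterior ℝ (closedCell L x)) : signVector L y = signVector L x :=
  signVector_eq_of_mem_closedCell hL (intrinsicInterior_subset hy)
    (subset_closedCell_of_mem_intrinsicInterior hL subset_rfl hy (self_mem_closedCell x))

end SignVectors

theorem mem_intrinsicInterior_closedCell {E : Type*} [NormedAddCommGroup E] [NormedSpace ℝ E]
    [FiniteDimensional ℝ E] {L : Finset (E →ᵃ[ℝ] ℝ)} (hL : ∀ ℓ ∈ L, -ℓ ∈ L) (x : E) :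
    x ∈ intrinsicInterior ℝ (closedCell L x) := by
  classical
  have hcell : closedCell L x = {y | ∀ ℓ ∈ L.filter fun ℓ => ℓ x ≤ 0, ℓ y ≤ 0} := by
    ext
    simp [closedCell]
  rw [hcell]
  refine mem_intrinsicInterior_of_forall_eq_zero (by simp) fun ℓ hℓ hzero y hy => ?_
  have hneg : -ℓ ∈ L.filter fun ℓ => ℓ x ≤ 0 := by
    simp [hL ℓ (Finset.mem_of_mem_filter ℓ hℓ), hzero]
  exact le_antisymm (hy ℓ hℓ) (by simpa using hy (-ℓ) hneg)

section Polyhedra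

variable {n : ℕ}

theorem exists_eq_dotProduct_sub (ℓ : (Fin n → ℝ) →ᵃ[ℝ] ℝ) :
    ∃ (a : Fin n → ℝ) (c : ℝ), ∀ x, ℓ x = a ⬝ᵥ x - c := by
  obtain ⟨a, ha⟩ := (dotProductEquiv ℝ (Fin n)).surjective ℓ.linear
  refine ⟨a, -ℓ 0, fun x => ?_⟩
  rw [sub_neg_eq_add, ← dotProductEquiv_apply_apply, ha]
  exact congrFun ℓ.decomp x

theorem exists_affineMap_eq_dotProduct_sub (a : Fin n → ℝ) (c : ℝ) :
    ∃ ℓ : (Fin n → ℝ) →ᵃ[ℝ] ℝ, ∀ x, ℓ x = a ⬝ᵥ x - c :=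
  ⟨(dotProductEquiv ℝ (Fin n) a).toAffineMap - AffineMap.const ℝ _ c, fun x => by simp⟩

theorem isPolyhedron_iff {P : Set (Fin n → ℝ)} :
    IsPolyhedron P ↔ ∃ L : Finset ((Fin n → ℝ) →ᵃ[ℝ] ℝ), P = {x | ∀ ℓ ∈ L, ℓ x ≤ 0} := by
  classical
  constructor
  · rintro ⟨m, A, b, rfl⟩
    choose ℓ hℓ using fun i => exists_affineMap_eq_dotProduct_sub (A i) (b i)
    refine ⟨Finset.univ.image ℓ, ?_⟩
    ext x
    simp [hℓ, Pi.le_def, Matrix.mulVec]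
  · rintro ⟨L, rfl⟩
    choose a c h using exists_eq_dotProduct_sub (n := n)
    refine ⟨L.card, Matrix.of fun i => a (L.equivFin.symm i), fun i => c (L.equivFin.symm i), ?_⟩
    ext x
    simp [Pi.le_def, Matrix.mulVec, h, L.equivFin.symm.forall_congr_left]

theorem isFaceOf_iff {F P : Set (Fin n → ℝ)} :
    IsFaceOf F P ↔ ∃ ℓ : (Fin n → ℝ) →ᵃ[ℝ] ℝ, (∀ x ∈ P, ℓ x ≤ 0) ∧ F = {x ∈ P | ℓ x = 0} := by
  constructor
  · rintro ⟨a, c, h, rfl⟩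
    obtain ⟨ℓ, hℓ⟩ := exists_affineMap_eq_dotProduct_sub a c
    exact ⟨ℓ, fun x hx => by simpa [hℓ] using h x hx, by simp [hℓ, sub_eq_zero]⟩
  · rintro ⟨ℓ, h, rfl⟩
    obtain ⟨a, c, hℓ⟩ := exists_eq_dotProduct_sub ℓ
    exact ⟨a, c, fun x hx => by simpa [hℓ] using h x hx, by simp [hℓ, sub_eq_zero]⟩

theorem isFaceOf_empty (P : Set (Fin n → ℝ)) : IsFaceOf ∅ P :=
  ⟨0, 1, by simp, by simp⟩

theorem isFaceOf_sep_forall_eq_zero {P : Set (Fin n → ℝ)} {M : Finset ((Fin n → ℝ) →ᵃ[ℝ] ℝ)}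
    (hM : ∀ ℓ ∈ M, ∀ x ∈ P, ℓ x ≤ 0) : IsFaceOf {x ∈ P | ∀ ℓ ∈ M, ℓ x = 0} P := by
  have hsum : ∀ x, (∑ ℓ ∈ M, ℓ) x = ∑ ℓ ∈ M, ℓ x := fun x =>
    map_sum (AddMonoidHom.mk' (fun ℓ : (Fin n → ℝ) →ᵃ[ℝ] ℝ => ℓ x) fun _ _ => rfl) _ M
  refine isFaceOf_iff.2 ⟨∑ ℓ ∈ M, ℓ, fun x hx => ?_, ?_⟩
  · rw [hsum]
    exact Finset.sum_nonpos fun ℓ hℓ => hM ℓ hℓ x hx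
  · ext x
    refine and_congr_right fun hx => ?_
    rw [hsum, Finset.sum_eq_zero_iff_of_nonpos fun ℓ hℓ => hM ℓ hℓ x hx]

variable {L : Finset ((Fin n → ℝ) →ᵃ[ℝ] ℝ)}

theorem isPolyhedron_closedCell (x : Fin n → ℝ) : IsPolyhedron (closedCell L x) := by
  classical
  refine isPolyhedron_iff.2 ⟨L.filter fun ℓ => ℓ x ≤ 0, ?_⟩
  ext
  simp [closedCell]

theorem isFaceOf_closedCell_inter (hL : ∀ ℓ ∈ L, -ℓ ∈ L) (x y : Fin n → ℝ) :
    IsFaceOf (closedCell L x ∩ closedCell L y) (closedCell L x) := by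
  classical
  let M := L.filter fun ℓ => ℓ x ≤ 0 ∧ 0 ≤ ℓ y
  have hinter : closedCell L x ∩ closedCell L y = {z ∈ closedCell L x | ∀ ℓ ∈ M, ℓ z = 0} := by
    ext z
    refine and_congr_right fun hz => ⟨fun hzy ℓ hℓ => ?_, fun hzM ℓ hℓ hℓy => ?_⟩
    · obtain ⟨hℓL, hℓx, hℓy⟩ := Finset.mem_filter.1 hℓ
      exact le_antisymm (hz ℓ hℓL hℓx) (by simpa using hzy (-ℓ) (hL ℓ hℓL) (by simpa using hℓy))
    · rcases le_or_gt (ℓ x) 0 with hℓx | hℓx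
      · exact hz ℓ hℓ hℓx
      · have hneg : -ℓ ∈ M := by simpa [M, hL ℓ hℓ] using ⟨hℓx.le, hℓy⟩
        exact (neg_eq_zero.1 (hzM (-ℓ) hneg)).le
  rw [hinter]
  refine isFaceOf_sep_forall_eq_zero fun ℓ hℓ z hz => ?_
  obtain ⟨hℓL, hℓx, -⟩ := Finset.mem_filter.1 hℓ
  exact hz ℓ hℓL hℓx

theorem exists_eq_closedCell_of_isFaceOf (hL : ∀ ℓ ∈ L, -ℓ ∈ L) {x : Fin n → ℝ}
    {F : Set (Fin n → ℝ)} (hF : IsFaceOf F (closedCell L x)) (hne : F.Nonempty) :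
    ∃ y, F = closedCell L y := by
  obtain ⟨φ, hφ, rfl⟩ := isFaceOf_iff.1 hF
  have hconvex : Convex ℝ {z ∈ closedCell L x | φ z = 0} :=
    (convex_closedCell x).inter ((convex_singleton 0).affine_preimage φ)
  obtain ⟨y, hy⟩ := hne.intrinsicInterior hconvex
  obtain ⟨hyx, hφy⟩ := intrinsicInterior_subset hy
  refine ⟨y, (subset_closedCell_of_mem_intrinsicInterior hL (Set.sep_subset _ _) hy).antisymm
    fun z hz => ⟨closedCell_subset_of_mem hyx hz, ?_⟩⟩
  have hmax : IsMaxOn φ (closedCell L y) y := fun w hw => by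
    simpa [hφy] using hφ w (closedCell_subset_of_mem hyx hw)
  rw [affineMap_eq_of_isMaxOn hmax (mem_intrinsicInterior_closedCell hL y) hz, hφy]

theorem isPolyhedralComplex_closedCell (hL : ∀ ℓ ∈ L, -ℓ ∈ L) :
    IsPolyhedralComplex (insert ∅ (Set.range (closedCell L))) where
  isPolyhedron := by
    rintro _ (rfl | ⟨x, rfl⟩)
    · exact isPolyhedron_iff.2 ⟨{AffineMap.const ℝ _ 1}, by ext; simp⟩
    · exact isPolyhedron_closedCell x
  inter_isFaceOf := by
    rintro _ (rfl | ⟨x, rfl⟩) _ (rfl | ⟨y, rfl⟩)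
    · simp [isFaceOf_empty]
    · simp [isFaceOf_empty]
    · simp [isFaceOf_empty]
    · exact ⟨isFaceOf_closedCell_inter hL x y,
        Set.inter_comm (closedCell L y) _ ▸ isFaceOf_closedCell_inter hL y x⟩
  face_mem := by
    rintro P hP F hF
    rcases F.eq_empty_or_nonempty with rfl | hne
    · exact .inl rfl
    rcases hP with rfl | ⟨x, rfl⟩
    · obtain ⟨ℓ, -, rfl⟩ := isFaceOf_iff.1 hF
      simp at hne
    · obtain ⟨y, rfl⟩ := exists_eq_closedCell_of_isFaceOf hL hF hne
      exact .inr ⟨y, rfl⟩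

theorem IsPolyhedralComplex.mem_intrinsicInterior_of_minimal {K : Set (Set (Fin n → ℝ))}
    (hK : IsPolyhedralComplex K) {P : Set (Fin n → ℝ)} {x : Fin n → ℝ}
    (hP : Minimal (fun Q => Q ∈ K ∧ x ∈ Q) P) : x ∈ intrinsicInterior ℝ P := by
  obtain ⟨hPK, hxP⟩ := hP.prop
  obtain ⟨M, rfl⟩ := isPolyhedron_iff.1 (hK.isPolyhedron P hPK)
  refine mem_intrinsicInterior_of_forall_eq_zero hxP fun ℓ hℓ hzero y hy => ?_
  have hface : IsFaceOf {z ∈ {z | ∀ ℓ ∈ M, ℓ z ≤ 0} | ℓ z = 0} {z | ∀ ℓ ∈ M, ℓ z ≤ 0} :=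
    isFaceOf_iff.2 ⟨ℓ, fun z hz => hz ℓ hℓ, rfl⟩
  exact (hP.le_of_le ⟨hK.face_mem _ hPK _ hface, hxP, hzero⟩ (Set.sep_subset _ _) hy).2

end Polyhedra

section AffineOnSignCells

/-- The affine functions on `E`, as a subspace of all real-valued functions. -/
def affineFunctions (E : Type*) [AddCommGroup E] [Module ℝ E] : Submodule ℝ (E → ℝ) where
  carrier := Set.range fun (g : E →ᵃ[ℝ] ℝ) (x : E) => g x
  zero_mem' := ⟨0, rfl⟩
  add_mem' := by
    rintro _ _ ⟨g, rfl⟩ ⟨h, rfl⟩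
    exact ⟨g + h, rfl⟩
  smul_mem' := by
    rintro c _ ⟨g, rfl⟩
    exact ⟨c • g, rfl⟩

/-- The signs of the maps in `L`, read off from those of the maps in a larger set `M`. -/
def restrictSigns {E : Type*} [AddCommGroup E] [Module ℝ E] {L M : Finset (E →ᵃ[ℝ] ℝ)}
    (hLM : L ⊆ M) (s : M → SignType) (ℓ : L) : SignType :=
  s ⟨ℓ, hLM ℓ.2⟩

/-- The functions that agree with an affine map on every cell of some hyperplane arrangement. This
is a description of piecewise linear functions that is easier to compute with than polyhedral
complexes: any two arrangements have a common refinement, their union. -/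
def affineOnSignCells (E : Type*) [AddCommGroup E] [Module ℝ E] : Submodule ℝ (E → ℝ) where
  carrier := {f | ∃ (L : Finset (E →ᵃ[ℝ] ℝ)) (g : (L → SignType) → E →ᵃ[ℝ] ℝ),
    ∀ x, f x = g (signVector L x) x}
  zero_mem' := ⟨∅, 0, fun _ => rfl⟩
  add_mem' := by
    classical
    rintro f f' ⟨L, g, hg⟩ ⟨L', g', hg'⟩
    exact ⟨L ∪ L', fun s => g (restrictSigns Finset.subset_union_left s) +
      g' (restrictSigns Finset.subset_union_right s),
      fun x => congrArg₂ (· + ·) (hg x) (hg' x)⟩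
  smul_mem' := by
    rintro c f ⟨L, g, hg⟩
    exact ⟨L, fun s => c • g s, fun x => congrArg (c • ·) (hg x)⟩

variable {E : Type*} [AddCommGroup E] [Module ℝ E] {f : E → ℝ}

theorem affineMap_mem_affineFunctions (g : E →ᵃ[ℝ] ℝ) : ⇑g ∈ affineFunctions E := ⟨g, rfl⟩

theorem affineFunctions_le_affineOnSignCells : affineFunctions E ≤ affineOnSignCells E := by
  rintro _ ⟨g, rfl⟩
  exact ⟨∅, fun _ => g, fun _ => rfl⟩

theorem mul_mem_affineOnSignCells {L : Finset (E →ᵃ[ℝ] ℝ)} (h : (L → SignType) → ℝ)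
    (hf : f ∈ affineOnSignCells E) : (h ∘ signVector L) * f ∈ affineOnSignCells E := by
  classical
  obtain ⟨M, g, hg⟩ := hf
  exact ⟨L ∪ M, fun s => h (restrictSigns Finset.subset_union_left s) •
    g (restrictSigns Finset.subset_union_right s),
    fun x => congrArg (h (signVector L x) * ·) (hg x)⟩

theorem exists_thresholdActivation_comp_eq (hf : f ∈ affineOnSignCells E) :
    ∃ (L : Finset (E →ᵃ[ℝ] ℝ)) (h : (L → SignType) → ℝ),
      thresholdActivation ∘ f = h ∘ signVector L := by
  classical
  obtain ⟨M, g, hg⟩ := hf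
  have hgmem : ∀ s, g s ∈ M ∪ Finset.univ.image g := fun s =>
    Finset.mem_union_right _ (Finset.mem_image_of_mem g (Finset.mem_univ s))
  refine ⟨M ∪ Finset.univ.image g, fun s => if s ⟨_, hgmem
    (restrictSigns Finset.subset_union_left s)⟩ = 1 then 1 else 0, funext fun x => ?_⟩
  have hsign : SignType.sign (f x) =
      signVector (M ∪ Finset.univ.image g) x ⟨_, hgmem (signVector M x)⟩ := by
    rw [hg]
    rfl
  exact if_congr (by rw [← sign_eq_one_iff, hsign]; rfl) rfl rfl

theorem thresholdActivation_comp_mul_mem {g : E → ℝ} (hf : f ∈ affineOnSignCells E)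
    (hg : g ∈ affineOnSignCells E) :
    (thresholdActivation ∘ f) * g ∈ affineOnSignCells E := by
  obtain ⟨L, h, hh⟩ := exists_thresholdActivation_comp_eq hf
  exact hh ▸ mul_mem_affineOnSignCells h hg

theorem thresholdActivation_comp_mem (hf : f ∈ affineOnSignCells E) :
    thresholdActivation ∘ f ∈ affineOnSignCells E := by
  have hone : (1 : E → ℝ) ∈ affineOnSignCells E :=
    affineFunctions_le_affineOnSignCells (affineMap_mem_affineFunctions (AffineMap.const ℝ E 1))
  simpa using thresholdActivation_comp_mul_mem hf hone

theorem reluActivation_comp_mem (hf : f ∈ affineOnSignCells E) :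
    reluActivation ∘ f ∈ affineOnSignCells E := by
  have hrelu : reluActivation ∘ f = (thresholdActivation ∘ f) * f := by
    funext x
    rcases le_or_gt (f x) 0 with hx | hx
    · simp [reluActivation, thresholdActivation, hx, hx.not_gt]
    · simp [reluActivation, thresholdActivation, hx, hx.le]
  exact hrelu ▸ thresholdActivation_comp_mul_mem hf hf

theorem exists_finset_forall_exists_eq (hf : f ∈ affineOnSignCells E) :
    ∃ G : Finset (E →ᵃ[ℝ] ℝ), ∀ x, ∃ g ∈ G, f x = g x := by
  classical
  obtain ⟨L, g, hg⟩ := hf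
  exact ⟨Finset.univ.image g, fun x => ⟨_, by simp, hg x⟩⟩

theorem PWL_subset_affineOnSignCells {n : ℕ} : PWL n ⊆ affineOnSignCells (Fin n → ℝ) := by
  classical
  rintro f ⟨K, hfin, hK, hcover, haffine⟩
  choose! M hM using fun P (hP : P ∈ K) => isPolyhedron_iff.1 (hK.isPolyhedron P hP)
  let L := hfin.toFinset.biUnion M
  have hpiece : ∀ s : L → SignType, ∃ g : (Fin n → ℝ) →ᵃ[ℝ] ℝ,
      ∀ x, signVector L x = s → f x = g x := by
    intro s
    rcases Classical.em (∃ x₀, signVector L x₀ = s) with ⟨x₀, rfl⟩ | hs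
    · obtain ⟨P₀, hP₀⟩ : ∃ P, P ∈ K ∧ x₀ ∈ P := Set.mem_sUnion.1 (hcover ▸ Set.mem_univ x₀)
      obtain ⟨P, hP⟩ := (hfin.subset (Set.sep_subset K (x₀ ∈ ·))).exists_minimal ⟨P₀, hP₀⟩
      obtain ⟨g, hg⟩ := haffine P hP.prop.1
      refine ⟨g, fun x hx => hg (hK.mem_intrinsicInterior_of_minimal ?_)⟩
      have hiff : ∀ Q ∈ K, x ∈ Q ↔ x₀ ∈ Q := by
        intro Q hQ
        rw [hM Q hQ]
        exact forall₂_congr fun ℓ hℓ => apply_nonpos_iff_of_signVector_eq hx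
          (Finset.mem_biUnion.2 ⟨Q, hfin.mem_toFinset.2 hQ, hℓ⟩)
      have hmem : (fun Q => Q ∈ K ∧ x ∈ Q) = fun Q => Q ∈ K ∧ x₀ ∈ Q :=
        funext fun Q => propext (and_congr_right (hiff Q))
      exact hmem ▸ hP
    · exact ⟨0, fun x hx => absurd ⟨x, hx⟩ hs⟩
  choose g hg using hpiece
  exact ⟨L, g, fun x => hg _ x rfl⟩

theorem affineOnSignCells_subset_PWL {n : ℕ} : ↑(affineOnSignCells (Fin n → ℝ)) ⊆ PWL n := by
  classical
  rintro f ⟨L, g, hg⟩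
  let M := L ∪ L.image (-·)
  have hM : ∀ ℓ ∈ M, -ℓ ∈ M := by
    intro ℓ hℓ
    rcases Finset.mem_union.1 hℓ with hℓL | hℓneg
    · exact Finset.mem_union_right _ (Finset.mem_image_of_mem _ hℓL)
    · obtain ⟨ℓ', hℓ', rfl⟩ := Finset.mem_image.1 hℓneg
      exact Finset.mem_union_left _ (by rwa [neg_neg])
  refine ⟨_, finite_range_closedCell.insert _, isPolyhedralComplex_closedCell hM,
    Set.eq_univ_of_forall fun x => ⟨_, .inr ⟨x, rfl⟩, self_mem_closedCell x⟩, ?_⟩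
  rintro _ (rfl | ⟨x₀, rfl⟩)
  · exact ⟨0, by simp⟩
  · refine ⟨g (signVector L x₀), fun x hx => ?_⟩
    rw [hg, signVector_eq_of_subset Finset.subset_union_left
      (signVector_eq_of_mem_intrinsicInterior_closedCell hM hx)]

theorem PWL_eq_affineOnSignCells {n : ℕ} : PWL n = affineOnSignCells (Fin n → ℝ) :=
  PWL_subset_affineOnSignCells.antisymm affineOnSignCells_subset_PWL

end AffineOnSignCells

section LinearRelationsBetweenMaxima

theorem sum_powerset_sup'_eq_zero {ι α R : Type*} [Ring R] [LinearOrder R] [DecidableEq ι]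
    {u : ι → α → R} {J T : Finset ι} (hT : T.Nonempty)
    (hle : ∀ x, ∃ j ∈ J, ∃ i ∈ T, u j x ≤ u i x) :
    ∑ S ∈ J.powerset,
      (-1 : R) ^ S.card • (T ∪ S).sup' (hT.mono Finset.subset_union_left) u = 0 := by
  funext x
  obtain ⟨j, hj, i, hi, hji⟩ := hle x
  have hinsert : ∀ S : Finset ι,
      (T ∪ insert j S).sup' (hT.mono Finset.subset_union_left) u x =
        (T ∪ S).sup' (hT.mono Finset.subset_union_left) u x := by
    intro S
    have hi' : u i x ≤ (T ∪ S).sup' (hT.mono Finset.subset_union_left) u x :=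
      Finset.le_sup' u (Finset.mem_union_left S hi) x
    simp only [Finset.union_insert]
    rw [Finset.sup'_insert (H := hT.mono Finset.subset_union_left), Pi.sup_apply,
      sup_eq_right.2 (hji.trans hi')]
  rw [← Finset.insert_erase hj, Finset.sum_powerset_insert (Finset.notMem_erase _ _),
    ← Finset.sum_add_distrib, Finset.sum_apply]
  refine Finset.sum_eq_zero fun S hS => ?_
  have hjS : j ∉ S := fun h => Finset.notMem_erase _ _ (Finset.mem_powerset.1 hS h)
  simp only [Finset.card_insert_of_notMem hjS, Pi.add_apply, Pi.smul_apply, hinsert, pow_succ,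
    smul_eq_mul]
  simp

variable {E : Type*} [AddCommGroup E] [Module ℝ E]

theorem exists_apply_le_apply_of_mem_convexHull {A B : Set (E →ᵃ[ℝ] ℝ)} {φ ψ : E →ᵃ[ℝ] ℝ}
    (hφ : φ ∈ convexHull ℝ A) (hψ : ψ ∈ convexHull ℝ B) {x : E} (h : φ x ≤ ψ x) :
    ∃ a ∈ A, ∃ b ∈ B, a x ≤ b x := by
  let evalAt : (E →ᵃ[ℝ] ℝ) →ₗ[ℝ] ℝ := ⟨⟨fun g => g x, fun _ _ => rfl⟩, fun _ _ => rfl⟩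
  obtain ⟨a, ha, hax⟩ : ∃ a ∈ A, a x ≤ φ x :=
    (evalAt.concaveOn convex_univ).exists_le_of_mem_convexHull (Set.subset_univ A) hφ
  obtain ⟨b, hb, hbx⟩ : ∃ b ∈ B, ψ x ≤ b x :=
    (evalAt.convexOn convex_univ).exists_ge_of_mem_convexHull (Set.subset_univ B) hψ
  exact ⟨a, ha, b, hb, hax.trans (h.trans hbx)⟩

theorem forall_le_or_forall_le_of_linear_eq {φ ψ : E →ᵃ[ℝ] ℝ} (h : φ.linear = ψ.linear) :
    (∀ x, φ x ≤ ψ x) ∨ ∀ x, ψ x ≤ φ x := by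
  have hle : ∀ x, φ x ≤ ψ x ↔ φ 0 ≤ ψ 0 := fun x => by
    rw [φ.decomp, ψ.decomp, h]
    simp
  have hge : ∀ x, ψ x ≤ φ x ↔ ψ 0 ≤ φ 0 := fun x => by
    rw [φ.decomp, ψ.decomp, h]
    simp
  simpa only [hle, hge, forall_const] using le_total (φ 0) (ψ 0)

theorem exists_subset_convexHull_le [FiniteDimensional ℝ E] [DecidableEq (E →ᵃ[ℝ] ℝ)]
    {s : Finset (E →ᵃ[ℝ] ℝ)} (hs : Module.finrank ℝ E + 1 < s.card) :
    ∃ J ⊆ s, ∃ φ ∈ convexHull ℝ (J : Set (E →ᵃ[ℝ] ℝ)),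
      ∃ ψ ∈ convexHull ℝ ((s \ J : Finset (E →ᵃ[ℝ] ℝ)) : Set (E →ᵃ[ℝ] ℝ)), ∀ x, φ x ≤ ψ x := by
  classical
  let linearPart : (E →ᵃ[ℝ] ℝ) →ₗ[ℝ] Module.Dual ℝ E :=
    ⟨⟨AffineMap.linear, fun _ _ => rfl⟩, fun _ _ => rfl⟩
  have hdep : ¬ AffineIndependent ℝ fun g : s => linearPart g := fun hindep => by
    have hcard := hindep.card_le_finrank_succ.trans (Nat.succ_le_succ (Submodule.finrank_le _))
    rw [Subspace.dual_finrank_eq, Fintype.card_coe] at hcard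
    exact hs.not_ge hcard
  obtain ⟨I, v, hv, hv'⟩ := Convex.radon_partition hdep
  have himage : ∀ I : Set s, (fun g : s => linearPart g) '' I = linearPart '' ((↑) '' I) :=
    fun I => (Set.image_image _ _ I).symm
  rw [himage, ← LinearMap.image_convexHull] at hv hv'
  obtain ⟨φ, hφ, rfl⟩ := hv
  obtain ⟨ψ, hψ, hψφ⟩ := hv'
  obtain ⟨J, hJ⟩ : ∃ J : Finset (E →ᵃ[ℝ] ℝ), (J : Set (E →ᵃ[ℝ] ℝ)) = (↑) '' I :=
    ((Set.toFinite I).image _).exists_finset_coe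
  have hJs : J ⊆ s := by
    rw [← Finset.coe_subset, hJ]
    exact Subtype.coe_image_subset _ I
  have hJc : ((s \ J : Finset (E →ᵃ[ℝ] ℝ)) : Set (E →ᵃ[ℝ] ℝ)) = (↑) '' Iᶜ := by
    rw [Finset.coe_sdiff, hJ, Set.image_compl_eq_range_sdiff_image Subtype.val_injective]
    simp
  rw [← hJ] at hφ
  rw [← hJc] at hψ
  rcases forall_le_or_forall_le_of_linear_eq hψφ with hle | hle
  · exact ⟨s \ J, Finset.sdiff_subset, ψ, hψ, φ, by rwa [Finset.sdiff_sdiff_eq_self hJs], hle⟩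
  · exact ⟨J, hJs, φ, hφ, ψ, hψ, hle⟩

theorem sup'_mem_of_forall_card_le [FiniteDimensional ℝ E] {V : Submodule ℝ (E → ℝ)}
    (hV : ∀ (t : Finset (E →ᵃ[ℝ] ℝ)) (ht : t.Nonempty), t.card ≤ Module.finrank ℝ E + 1 →
      t.sup' ht (fun g => ⇑g) ∈ V)
    (s : Finset (E →ᵃ[ℝ] ℝ)) (hs : s.Nonempty) : s.sup' hs (fun g => ⇑g) ∈ V := by
  classical
  induction s using Finset.strongInduction with
  | H s ih =>
    rcases le_or_gt s.card (Module.finrank ℝ E + 1) with hcard | hcard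
    · exact hV s hs hcard
    obtain ⟨J, hJs, φ, hφ, ψ, hψ, hφψ⟩ := exists_subset_convexHull_le hcard
    have hle : ∀ x, ∃ j ∈ J, ∃ i ∈ s \ J, j x ≤ i x := fun x =>
      exists_apply_le_apply_of_mem_convexHull hφ hψ (hφψ x)
    obtain ⟨-, -, i, hi, -⟩ := hle 0
    have hT : (s \ J).Nonempty := ⟨i, hi⟩
    have hzero := sum_powerset_sup'_eq_zero hT hle
    rw [← Finset.sum_erase_add _ _ (Finset.mem_powerset_self J)] at hzero
    have hmem : ∑ S ∈ J.powerset.erase J, (-1 : ℝ) ^ S.card •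
        (s \ J ∪ S).sup' (hT.mono Finset.subset_union_left) (fun g => ⇑g) ∈ V := by
      refine V.sum_mem fun S hS => V.smul_mem _ (ih _ ?_ _)
      obtain ⟨hne, hSJ⟩ := Finset.mem_erase.1 hS
      rw [Finset.mem_powerset] at hSJ
      obtain ⟨j, hj, hjS⟩ := Finset.exists_of_ssubset (hSJ.ssubset_of_ne hne)
      exact (Finset.ssubset_iff_of_subset (Finset.union_subset Finset.sdiff_subset
        (hSJ.trans hJs))).2 ⟨j, hJs hj, by simp [hj, hjS]⟩
    rw [eq_neg_of_add_eq_zero_left hzero, V.neg_mem_iff,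
      V.smul_mem_iff (pow_ne_zero _ (neg_ne_zero.2 one_ne_zero))] at hmem
    simpa only [Finset.sdiff_union_of_subset hJs] using hmem

end LinearRelationsBetweenMaxima

section DifferencesOfMaxima

open scoped Pointwise

variable {α : Type*} [Lattice α] [AddCommGroup α] [AddLeftMono α]

theorem supClosure_add_supClosure_subset (A B : Set α) :
    supClosure A + supClosure B ⊆ supClosure (A + B) := by
  have hsup : SupClosed (supClosure (A + B)) := supClosed_supClosure
  have hleft : ∀ b ∈ B, supClosure A ⊆ {a | a + b ∈ supClosure (A + B)} := fun b hb =>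
    supClosure_min (fun a ha => subset_supClosure (Set.add_mem_add ha hb))
      fun a ha a' ha' => by simpa only [Set.mem_ofPred_eq, sup_add] using hsup ha ha'
  have hright : ∀ a ∈ supClosure A, supClosure B ⊆ {b | a + b ∈ supClosure (A + B)} := fun a ha =>
    supClosure_min (fun b hb => hleft b hb ha)
      fun b hb b' hb' => by simpa only [Set.mem_ofPred_eq, add_sup] using hsup hb hb'
  rintro _ ⟨a, ha, b, hb, rfl⟩
  exact hright a ha hb

theorem isSublattice_sub_of_supClosed {S : Set α} (hS : SupClosed S) (hadd : S + S ⊆ S) :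
    IsSublattice (S - S) where
  supClosed := by
    rintro _ ⟨a, ha, b, hb, rfl⟩ _ ⟨c, hc, d, hd, rfl⟩
    refine ⟨(a + d) ⊔ (c + b), hS (hadd ⟨a, ha, d, hd, rfl⟩) (hadd ⟨c, hc, b, hb, rfl⟩), b + d,
      hadd ⟨b, hb, d, hd, rfl⟩, ?_⟩
    simp only [sub_eq_add_neg, sup_add]
    congr 1 <;> abel
  infClosed := by
    rintro _ ⟨a, ha, b, hb, rfl⟩ _ ⟨c, hc, d, hd, rfl⟩
    refine ⟨a + c, hadd ⟨a, ha, c, hc, rfl⟩, (b + c) ⊔ (a + d),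
      hS (hadd ⟨b, hb, c, hc, rfl⟩) (hadd ⟨a, ha, d, hd, rfl⟩), ?_⟩
    simp only [sub_eq_add_neg, neg_sup, add_inf]
    congr 1 <;> abel

theorem latticeClosure_subset_supClosure_sub_supClosure (A : AddSubmonoid α) :
    latticeClosure (A : Set α) ⊆ supClosure A - supClosure A := by
  have hadd : supClosure (A : Set α) + supClosure A ⊆ supClosure A := by
    have h := supClosure_add_supClosure_subset (A : Set α) A
    rwa [AddSubmonoid.coe_add_self_eq] at h
  refine latticeClosure_min (fun a ha => ?_)
    (isSublattice_sub_of_supClosed supClosed_supClosure hadd)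
  exact ⟨a, subset_supClosure ha, 0, subset_supClosure A.zero_mem, sub_zero a⟩

theorem latticeClosure_affineFunctions_subset {E : Type*} [AddCommGroup E] [Module ℝ E]
    {V : Submodule ℝ (E → ℝ)}
    (hV : ∀ (s : Finset (E →ᵃ[ℝ] ℝ)) (hs : s.Nonempty), s.sup' hs (fun g => ⇑g) ∈ V) :
    latticeClosure (affineFunctions E : Set (E → ℝ)) ⊆ V := by
  classical
  have hsup : supClosure (affineFunctions E : Set (E → ℝ)) ⊆ V := by
    rintro _ ⟨t, ht, htA, rfl⟩
    obtain ⟨s, -, rfl⟩ := Finset.subset_set_image_iff.1 (htA.trans Set.image_univ.ge)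
    rw [Finset.sup'_image]
    exact hV s _
  refine (latticeClosure_subset_supClosure_sub_supClosure
    (affineFunctions E).toAddSubmonoid).trans ?_
  rintro _ ⟨a, ha, b, hb, rfl⟩
  exact V.sub_mem (hsup ha) (hsup hb)

end DifferencesOfMaxima

section ContinuousSelections

theorem eventually_exists_eq_of_selection {ι X Y : Type*} [TopologicalSpace X]
    [TopologicalSpace Y] [T2Space Y] {G : Finset ι} {p : ι → X → Y} {φ : X → Y} {t : X}
    (hφ : ContinuousAt φ t) (hp : ∀ i ∈ G, ContinuousAt (p i) t)
    (hsel : ∀ r, ∃ i ∈ G, φ r = p i r) :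
    ∀ᶠ r in nhds t, ∃ i ∈ G, φ r = p i r ∧ φ t = p i t := by
  have hne : ∀ᶠ r in nhds t, ∀ i ∈ G, φ t ≠ p i t → φ r ≠ p i r := by
    refine G.eventually_all.2 fun i hi => ?_
    by_cases h : φ t = p i t
    · exact .of_forall fun _ hne => absurd h hne
    · exact (hφ.ne_iff_eventually_ne (hp i hi) |>.1 h).mono fun _ hr _ => hr
  filter_upwards [hne] with r hr
  obtain ⟨i, hi, hir⟩ := hsel r
  exact ⟨i, hi, hir, not_imp_not.1 (hr i hi) hir⟩

/- If no `p i` crossed zero upwards, `φ` would be negative just to the right of any point where it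
is nonpositive, and could not reach a nonnegative value at `b`. -/
theorem exists_nonpos_nonneg_of_selection {ι : Type*} {G : Finset ι} {p : ι → ℝ → ℝ}
    {φ : ℝ → ℝ} {a b : ℝ} (hφ : Continuous φ) (hp : ∀ i ∈ G, Continuous (p i))
    (hsel : ∀ r, ∃ i ∈ G, φ r = p i r) (hab : a < b) (ha : φ a ≤ 0) (hb : 0 ≤ φ b) :
    ∃ i ∈ G, ∃ s ∈ Set.Icc a b, ∃ t ∈ Set.Icc a b, s < t ∧ p i s ≤ 0 ∧ 0 ≤ p i t := by
  by_contra! hcross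
  have hnear : ∀ t, ∀ᶠ r in nhds t, ∃ i ∈ G, φ r = p i r ∧ φ t = p i t := fun t =>
    eventually_exists_eq_of_selection hφ.continuousAt (fun i hi => (hp i hi).continuousAt) hsel
  have hnonpos : Set.Icc a b ⊆ {t | φ t ≤ 0} := by
    have hclosed : IsClosed ({t | φ t ≤ 0} ∩ Set.Icc a b) :=
      (isClosed_le hφ continuous_const).inter isClosed_Icc
    refine hclosed.Icc_subset_of_forall_mem_nhdsWithin ha fun t ⟨ht, hta, htb⟩ => ?_
    filter_upwards [(hnear t).filter_mono nhdsWithin_le_nhds, Ioo_mem_nhdsGT htb]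
      with r ⟨i, hi, hr, hit⟩ ⟨htr, hrb⟩
    exact hr.trans_le (hcross i hi t ⟨hta, htb.le⟩ r ⟨hta.trans htr.le, hrb.le⟩ htr
      (hit ▸ ht)).le
  obtain ⟨r, ⟨i, hi, hr, hib⟩, har, hrb⟩ :=
    (((hnear b).filter_mono nhdsWithin_le_nhds).and (Ioo_mem_nhdsLT hab)).exists
  exact (hcross i hi r ⟨har.le, hrb.le⟩ b (Set.right_mem_Icc.2 hab.le) hrb
    (hr ▸ hnonpos ⟨har.le, hrb.le⟩)).not_ge (hib ▸ hb)

variable {E : Type*} [AddCommGroup E] [Module ℝ E] [TopologicalSpace E]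
  [IsTopologicalAddGroup E] [ContinuousSMul ℝ E] {f : E → ℝ} {G : Finset (E →ᵃ[ℝ] ℝ)}

theorem exists_le_and_ge_of_selection (hf : Continuous f) (hsel : ∀ x, ∃ g ∈ G, f x = g x)
    (a b : E) : ∃ g ∈ G, g a ≤ f a ∧ f b ≤ g b := by
  let line : ℝ →ᵃ[ℝ] E := AffineMap.lineMap a b
  let chord : ℝ →ᵃ[ℝ] ℝ := AffineMap.lineMap (f a) (f b)
  have hline : Continuous line := AffineMap.lineMap_continuous
  have hchord : Continuous chord := AffineMap.lineMap_continuous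
  obtain ⟨g, hg, s, ⟨hs, -⟩, t, ⟨-, ht⟩, hst, hgs, hgt⟩ :=
    exists_nonpos_nonneg_of_selection (G := G) (p := fun g => (g.comp line - chord : ℝ →ᵃ[ℝ] ℝ))
      (φ := fun r => f (line r) - chord r) (a := 0) (b := 1) ((hf.comp hline).sub hchord)
      (fun g _ => (g.comp line - chord).continuous_of_finiteDimensional)
      (fun r => (hsel (line r)).imp fun g ⟨hg, h⟩ => ⟨hg, congrArg (· - chord r) h⟩)
      one_pos (by simp [line, chord]) (by simp [line, chord])
  simp only [AffineMap.comp_lineMap, AffineMap.coe_sub, Pi.sub_apply,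
    AffineMap.lineMap_apply_ring', tsub_le_iff_right, zero_add, sub_nonneg, line, chord] at hgs hgt
  have hslope : 0 ≤ (g b - g a) - (f b - f a) := by nlinarith
  exact ⟨g, hg, by nlinarith, by nlinarith⟩

theorem mem_latticeClosure_of_selection (hf : Continuous f) (hsel : ∀ x, ∃ g ∈ G, f x = g x) :
    f ∈ latticeClosure (affineFunctions E : Set (E → ℝ)) := by
  classical
  let above (b : E) : Finset (E →ᵃ[ℝ] ℝ) := G.filter fun g => f b ≤ g b
  have hne (b : E) : (above b).Nonempty := by
    obtain ⟨g, hg, h⟩ := hsel b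
    exact ⟨g, Finset.mem_filter.2 ⟨hg, h.le⟩⟩
  let lower (b : E) : E → ℝ := (above b).inf' (hne b) fun g => ⇑g
  have hfin : (Set.range lower).Finite := by
    refine (G.powerset.finite_toSet.image fun S : Finset (E →ᵃ[ℝ] ℝ) =>
      if h : S.Nonempty then S.inf' h fun g => ⇑g else 0).subset ?_
    rintro _ ⟨b, rfl⟩
    exact ⟨above b, Finset.mem_powerset.2 (Finset.filter_subset _ _), dif_pos (hne b)⟩
  let T := hfin.toFinset
  have hT : T.Nonempty := ⟨lower 0, by simp [T]⟩
  have hmem : ∀ φ ∈ T, φ ∈ latticeClosure (affineFunctions E : Set (E → ℝ)) := by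
    intro φ hφ
    obtain ⟨b, rfl⟩ := hfin.mem_toFinset.1 hφ
    exact isSublattice_latticeClosure.infClosed.finsetInf'_mem _ fun g _ =>
      subset_latticeClosure (affineMap_mem_affineFunctions g)
  have hsup : f = T.sup' hT id := by
    funext a
    rw [Finset.sup'_apply]
    refine le_antisymm ?_ (Finset.sup'_le _ _ fun φ hφ => ?_)
    · refine Finset.le_sup'_of_le (b := lower a) _ (by simp [T]) ?_
      simp [lower, above]
    · obtain ⟨b, rfl⟩ := hfin.mem_toFinset.1 hφ
      obtain ⟨g, hg, hga, hgb⟩ := exists_le_and_ge_of_selection hf hsel a b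
      simp only [lower, id, Finset.inf'_apply]
      exact (Finset.inf'_le _ (Finset.mem_filter.2 ⟨hg, hgb⟩)).trans hga
  rw [hsup]
  exact isSublattice_latticeClosure.supClosed.finsetSup'_mem hT hmem

end ContinuousSelections

section NetworkFunctions

/-- The functions computed by networks with `k` hidden layers and activation `σ`, described without
reference to widths: the next layer consists of the linear combinations of constants and of
activations of functions from the previous one. -/
def networkFunctions (σ : ℝ → ℝ) (E : Type*) [AddCommGroup E] [Module ℝ E] :
    ℕ → Submodule ℝ (E → ℝ)
  | 0 => affineFunctions E
  | k + 1 => Submodule.span ℝ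
      (insert 1 ((σ ∘ ·) '' (networkFunctions σ E k : Set (E → ℝ))))

section

variable {σ : ℝ → ℝ} {E : Type*} [AddCommGroup E] [Module ℝ E] {k : ℕ}

theorem one_mem_networkFunctions : (1 : E → ℝ) ∈ networkFunctions σ E k := by
  cases k with
  | zero => exact affineMap_mem_affineFunctions (AffineMap.const ℝ E 1)
  | succ k => exact Submodule.subset_span (Set.mem_insert _ _)

theorem activation_comp_mem_networkFunctions {f : E → ℝ} (hf : f ∈ networkFunctions σ E k) :
    σ ∘ f ∈ networkFunctions σ E (k + 1) :=
  Submodule.subset_span (Set.mem_insert_of_mem _ ⟨f, hf, rfl⟩)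

theorem networkFunctions_le {V : Submodule ℝ (E → ℝ)} (haffine : affineFunctions E ≤ V)
    (hσ : ∀ f ∈ V, σ ∘ f ∈ V) : networkFunctions σ E k ≤ V := by
  induction k with
  | zero => exact haffine
  | succ k ih =>
    refine Submodule.span_le.2 (Set.insert_subset ?_ ?_)
    · exact haffine (affineMap_mem_affineFunctions (AffineMap.const ℝ E 1))
    · rintro _ ⟨f, hf, rfl⟩
      exact hσ f (ih hf)

end

theorem affineMap_comp_mem {X : Type*} {V : Submodule ℝ (X → ℝ)} (hone : 1 ∈ V) {w : ℕ}
    {u : X → Fin w → ℝ} (hu : ∀ i, (fun x => u x i) ∈ V) (T : (Fin w → ℝ) →ᵃ[ℝ] ℝ) :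
    (fun x => T (u x)) ∈ V := by
  obtain ⟨a, c, hT⟩ := exists_eq_dotProduct_sub T
  have hcomb : (fun x => T (u x)) = ∑ i, a i • (fun x => u x i) - c • (1 : X → ℝ) := by
    ext x
    simp [hT, dotProduct]
  rw [hcomb]
  exact V.sub_mem (V.sum_mem fun i _ => V.smul_mem _ (hu i)) (V.smul_mem c hone)

variable {σ : ℝ → ℝ} {n k : ℕ}

theorem affineMap_comp_eval_mem_networkFunctions {w : ℕ} (H : HiddenLayers n k w)
    (T : (Fin w → ℝ) →ᵃ[ℝ] ℝ) :
    (fun x => T (H.eval σ x)) ∈ networkFunctions σ (Fin n → ℝ) k := by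
  induction H with
  | input => exact affineMap_mem_affineFunctions T
  | layer H S ih =>
    exact affineMap_comp_mem one_mem_networkFunctions (fun j =>
      activation_comp_mem_networkFunctions (ih ((AffineMap.proj j).comp S))) T

theorem exists_finset_subset_span {ι X : Type*} [Finite ι] {F : ι → X → ℝ} {S : Set (X → ℝ)}
    (hF : ∀ i, F i ∈ Submodule.span ℝ (insert 1 ((σ ∘ ·) '' S))) :
    ∃ t : Finset (X → ℝ), ↑t ⊆ S ∧
      ∀ i, F i ∈ Submodule.span ℝ (insert 1 ((σ ∘ ·) '' (t : Set (X → ℝ)))) := by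
  classical
  obtain ⟨F', hF'⟩ := (Set.finite_range F).exists_finset_coe
  obtain ⟨R, hRS, hR⟩ := Submodule.subset_span_finite_of_subset_span (t := F')
    (s := insert 1 ((σ ∘ ·) '' S)) (by rw [hF']; rintro _ ⟨i, rfl⟩; exact hF i)
  have hR' : ↑(R.erase 1) ⊆ (σ ∘ ·) '' S := by
    rw [Finset.coe_erase]
    exact Set.sdiff_singleton_subset_iff.2 hRS
  obtain ⟨t, htS, ht⟩ := Finset.subset_set_image_iff.1 hR'
  refine ⟨t, htS, fun i => Submodule.span_mono ?_ (hR (hF' ▸ Set.mem_range_self i))⟩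
  rw [← Finset.coe_image, ht, Finset.coe_erase]
  exact Set.subset_insert_sdiff_singleton 1 _

theorem exists_hiddenLayers_eq_affineMap_comp {m : ℕ} {F : Fin m → (Fin n → ℝ) → ℝ}
    (hF : ∀ i, F i ∈ networkFunctions σ (Fin n → ℝ) k) :
    ∃ (w : ℕ) (H : HiddenLayers n k w) (T : (Fin w → ℝ) →ᵃ[ℝ] (Fin m → ℝ)),
      ∀ x i, F i x = T (H.eval σ x) i := by
  induction k generalizing m with
  | zero =>
    choose g hg using hF
    exact ⟨n, .input, AffineMap.pi g, fun x i => (congrFun (hg i) x).symm⟩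
  | succ k ih =>
    obtain ⟨t, htS, ht⟩ := exists_finset_subset_span hF
    obtain ⟨w, H, T, hT⟩ := ih (F := fun j => t.equivFin.symm j) fun j =>
      htS (t.equivFin.symm j).2
    let outputs := (affineFunctions (Fin t.card → ℝ)).map
      (LinearMap.funLeft ℝ ℝ ((H.layer T).eval σ))
    have hspan : Submodule.span ℝ (insert 1 ((σ ∘ ·) '' (t : Set _))) ≤ outputs := by
      refine Submodule.span_le.2 (Set.insert_subset ?_ ?_)
      · exact ⟨1, affineMap_mem_affineFunctions (AffineMap.const ℝ _ 1), rfl⟩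
      · rintro _ ⟨f, hf, rfl⟩
        refine ⟨_, affineMap_mem_affineFunctions (AffineMap.proj (t.equivFin ⟨f, hf⟩)), ?_⟩
        funext x
        simp [HiddenLayers.eval, ← hT]
    choose g hg hgF using fun i => hspan (ht i)
    choose g' hg' using hg
    exact ⟨_, H.layer T, AffineMap.pi g', fun x i => by
      rw [← hgF, ← hg']
      rfl⟩

theorem ReLUClass_eq_networkFunctions :
    ReLUClass n k = networkFunctions reluActivation (Fin n → ℝ) k := by
  ext f
  constructor
  · rintro ⟨N, hN⟩
    rw [show f = _ from funext hN]
    exact affineMap_comp_eval_mem_networkFunctions N.hidden ((AffineMap.proj 0).comp N.output)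
  · intro hf
    obtain ⟨w, H, T, hT⟩ := exists_hiddenLayers_eq_affineMap_comp (F := fun _ : Fin 1 => f)
      fun _ => hf
    exact ⟨⟨w, H, T⟩, fun x => hT x 0⟩

theorem mem_SLTClass_succ_iff {f : (Fin n → ℝ) → ℝ} :
    f ∈ SLTClass n (k + 1) ↔ ∃ (m : ℕ) (g : Fin m → (Fin n → ℝ) →ᵃ[ℝ] ℝ)
      (h : Fin m → (Fin n → ℝ) → ℝ),
      (∀ i, h i ∈ networkFunctions thresholdActivation (Fin n → ℝ) k) ∧
        f = ∑ i, (thresholdActivation ∘ h i) * ⇑(g i) := by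
  constructor
  · rintro ⟨⟨m, hidden, A, b⟩, hf⟩
    obtain _ | ⟨H, T⟩ := hidden
    choose g hg using fun i => exists_affineMap_eq_dotProduct_sub (Aᵀ i) (-b i)
    refine ⟨m, g, fun i x => T (H.eval thresholdActivation x) i, fun i =>
      affineMap_comp_eval_mem_networkFunctions H ((AffineMap.proj i).comp T), ?_⟩
    funext x
    simp [hf, ShortcutNetwork.eval, dotProduct, hg, Matrix.mulVec, HiddenLayers.eval, mul_comm]
  · rintro ⟨m, g, h, hh, rfl⟩
    obtain ⟨w, H, T, hT⟩ := exists_hiddenLayers_eq_affineMap_comp hh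
    choose a c hg using fun i => exists_eq_dotProduct_sub (g i)
    refine ⟨⟨m, H.layer T, (Matrix.of a)ᵀ, -c⟩, fun x => ?_⟩
    simp [ShortcutNetwork.eval, dotProduct, hg, Matrix.mulVec, HiddenLayers.eval, mul_comm, hT,
      sub_eq_add_neg]

end NetworkFunctions

section ReLUNetworks

variable {E : Type*} [AddCommGroup E] [Module ℝ E] {f g : E → ℝ} {k : ℕ}

theorem networkFunctions_reluActivation_le_succ :
    networkFunctions reluActivation E k ≤ networkFunctions reluActivation E (k + 1) := by
  intro f hf
  have hrelu : f = reluActivation ∘ f - reluActivation ∘ (-f) := by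
    funext x
    simp [reluActivation, max_comm (0 : ℝ), max_zero_sub_max_neg_zero_eq_self]
  rw [hrelu]
  exact Submodule.sub_mem _ (activation_comp_mem_networkFunctions hf)
    (activation_comp_mem_networkFunctions (Submodule.neg_mem _ hf))

theorem sup_mem_networkFunctions_reluActivation
    (hf : f ∈ networkFunctions reluActivation E k)
    (hg : g ∈ networkFunctions reluActivation E k) :
    f ⊔ g ∈ networkFunctions reluActivation E (k + 1) := by
  have hrelu : f ⊔ g = f + reluActivation ∘ (g - f) := by
    funext x
    simp [reluActivation, ← max_add_add_left]
  rw [hrelu]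
  exact Submodule.add_mem _ (networkFunctions_reluActivation_le_succ hf)
    (activation_comp_mem_networkFunctions (Submodule.sub_mem _ hg hf))

theorem sup'_mem_networkFunctions_reluActivation {s : Finset (E →ᵃ[ℝ] ℝ)} (hs : s.Nonempty)
    (hcard : s.card ≤ 2 ^ k) :
    s.sup' hs (fun g => ⇑g) ∈ networkFunctions reluActivation E k := by
  classical
  induction k generalizing s with
  | zero =>
    obtain ⟨g, rfl⟩ := Finset.card_eq_one.1 (hcard.antisymm hs.card_pos)
    exact affineMap_mem_affineFunctions g
  | succ k ih =>
    rcases le_or_gt s.card (2 ^ k) with hle | hlt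
    · exact networkFunctions_reluActivation_le_succ (ih hs hle)
    obtain ⟨t, hts, ht⟩ := Finset.exists_subset_card_eq hlt.le
    have htcard : (s \ t).card + t.card = s.card := Finset.card_sdiff_add_card_eq_card hts
    have htne : t.Nonempty := Finset.card_pos.1 (ht ▸ pow_pos two_pos k)
    have hdiff : (s \ t).Nonempty := Finset.card_pos.1 (by omega)
    have hunion := Finset.sup'_union hdiff htne fun g : E →ᵃ[ℝ] ℝ => (g : E → ℝ)
    simp only [Finset.sdiff_union_of_subset hts] at hunion
    rw [hunion]
    exact sup_mem_networkFunctions_reluActivation (ih hdiff (by omega)) (ih htne ht.le)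

variable [TopologicalSpace E] [IsTopologicalAddGroup E] [ContinuousSMul ℝ E]

theorem mem_networkFunctions_reluActivation_of_continuous [FiniteDimensional ℝ E]
    (hk : Module.finrank ℝ E + 1 ≤ 2 ^ k) (hf : f ∈ affineOnSignCells E) (hcont : Continuous f) :
    f ∈ networkFunctions reluActivation E k := by
  obtain ⟨G, hsel⟩ := exists_finset_forall_exists_eq hf
  exact latticeClosure_affineFunctions_subset (sup'_mem_of_forall_card_le fun t ht hcard =>
    sup'_mem_networkFunctions_reluActivation ht (hcard.trans hk))
    (mem_latticeClosure_of_selection hcont hsel)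

theorem networkFunctions_reluActivation_le [T2Space E] [FiniteDimensional ℝ E] :
    networkFunctions reluActivation E k ≤ affineOnSignCells E ⊓ continuousSubmodule E ℝ ℝ := by
  refine networkFunctions_le (le_inf affineFunctions_le_affineOnSignCells ?_) fun f hf =>
    ⟨reluActivation_comp_mem hf.1, continuous_const.max hf.2⟩
  rintro _ ⟨g, rfl⟩
  exact AffineMap.continuous_linear_iff.1 g.linear.continuous_of_finiteDimensional

theorem ReLUClass_eq_CPWL {n : ℕ} (hk : n + 1 ≤ 2 ^ k) : ReLUClass n k = CPWL n := by
  rw [ReLUClass_eq_networkFunctions]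
  unfold CPWL
  rw [PWL_eq_affineOnSignCells]
  refine Set.Subset.antisymm networkFunctions_reluActivation_le fun f hf => ?_
  refine mem_networkFunctions_reluActivation_of_continuous ?_ hf.1 hf.2
  rwa [Module.finrank_fin_fun]

end ReLUNetworks

section ThresholdNetworks

variable {E : Type*} [AddCommGroup E] [Module ℝ E]

theorem indicator_sign_eq_mem_networkFunctions (ℓ : E →ᵃ[ℝ] ℝ) (s : SignType) :
    (fun x => if SignType.sign (ℓ x) = s then (1 : ℝ) else 0) ∈
      networkFunctions thresholdActivation E 1 := by
  have hpos : thresholdActivation ∘ ℓ ∈ networkFunctions thresholdActivation E 1 :=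
    activation_comp_mem_networkFunctions (affineMap_mem_affineFunctions ℓ)
  have hneg : thresholdActivation ∘ ⇑(-ℓ) ∈ networkFunctions thresholdActivation E 1 :=
    activation_comp_mem_networkFunctions (affineMap_mem_affineFunctions (-ℓ))
  have hzero := Submodule.sub_mem _ (Submodule.sub_mem _ one_mem_networkFunctions hpos) hneg
  cases s
  · convert hzero using 2 with x
    rcases lt_trichotomy (ℓ x) 0 with h | h | h
    · simp [thresholdActivation, h, h.not_gt]
    · simp [thresholdActivation, h]
    · simp [thresholdActivation, h, h.not_gt]
  · convert hneg using 2 with x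
    simp [thresholdActivation, sign_eq_neg_one_iff]
  · convert hpos using 2 with x
    simp [thresholdActivation, sign_eq_one_iff]

theorem hammingDist_signVector_mem_networkFunctions (L : Finset (E →ᵃ[ℝ] ℝ)) (s : L → SignType) :
    (fun x => (hammingDist (signVector L x) s : ℝ)) ∈
      networkFunctions thresholdActivation E 1 := by
  have hsum : (fun x => (hammingDist (signVector L x) s : ℝ)) =
      ∑ ℓ : L, (1 - fun x => if SignType.sign (ℓ.1 x) = s ℓ then (1 : ℝ) else 0) := by
    funext x
    rw [hammingDist, Finset.natCast_card_filter, Finset.sum_apply]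
    refine Finset.sum_congr rfl fun ℓ _ => ?_
    by_cases h : SignType.sign (ℓ.1 x) = s ℓ <;> simp [signVector, h]
  rw [hsum]
  exact Submodule.sum_mem _ fun ℓ _ => Submodule.sub_mem _ one_mem_networkFunctions
    (indicator_sign_eq_mem_networkFunctions ℓ.1 (s ℓ))

theorem thresholdActivation_one_sub_hammingDist {ι β : Type*} [Fintype ι] [DecidableEq β]
    (s t : ι → β) :
    thresholdActivation (1 - hammingDist s t) = if s = t then 1 else 0 := by
  simp [thresholdActivation]

theorem PWL_subset_SLTClass {n : ℕ} : PWL n ⊆ SLTClass n 2 := by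
  classical
  rw [PWL_eq_affineOnSignCells]
  rintro f ⟨L, g, hg⟩
  let e := (Fintype.equivFin (L → SignType)).symm
  let h (s : L → SignType) (x : Fin n → ℝ) : ℝ := 1 - hammingDist (signVector L x) s
  have hf : f = ∑ s, (thresholdActivation ∘ h s) * ⇑(g s) := by
    funext x
    simp [hg, h, thresholdActivation_one_sub_hammingDist]
  refine mem_SLTClass_succ_iff.2 ⟨_, g ∘ e, h ∘ e, fun i => ?_, ?_⟩
  · exact Submodule.sub_mem _ one_mem_networkFunctions
      (hammingDist_signVector_mem_networkFunctions L (e i))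
  · exact hf.trans (e.sum_comp _).symm

theorem SLTClass_succ_subset_PWL {n k : ℕ} : SLTClass n (k + 1) ⊆ PWL n := by
  rw [PWL_eq_affineOnSignCells]
  intro f hf
  obtain ⟨m, g, h, hh, rfl⟩ := mem_SLTClass_succ_iff.1 hf
  have hle : networkFunctions thresholdActivation (Fin n → ℝ) k ≤ affineOnSignCells _ :=
    networkFunctions_le affineFunctions_le_affineOnSignCells fun _ => thresholdActivation_comp_mem
  exact Submodule.sum_mem _ fun i _ => thresholdActivation_comp_mul_mem (hle (hh i))
    (affineFunctions_le_affineOnSignCells (affineMap_mem_affineFunctions (g i)))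

theorem not_continuous_thresholdActivation : ¬ Continuous thresholdActivation := by
  intro hcont
  have hpreimage : thresholdActivation ⁻¹' {1} = Set.Ioi 0 := by
    ext t
    simp [thresholdActivation]
  have hclosed : IsClosed (Set.Ioi (0 : ℝ)) := hpreimage ▸ isClosed_singleton.preimage hcont
  exact Set.self_notMem_Ioi (hclosed.closure_eq ▸ closure_Ioi (0 : ℝ) ▸ Set.self_mem_Ici)

theorem CPWL_ssubset_PWL {n : ℕ} (hn : 1 ≤ n) : CPWL n ⊂ PWL n := by
  refine ⟨fun f hf => hf.1, fun hsub => not_continuous_thresholdActivation ?_⟩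
  let coordinate : (Fin n → ℝ) →ᵃ[ℝ] ℝ := AffineMap.proj ⟨0, hn⟩
  have hmem : thresholdActivation ∘ coordinate ∈ PWL n := by
    rw [PWL_eq_affineOnSignCells]
    exact thresholdActivation_comp_mem
      (affineFunctions_le_affineOnSignCells (affineMap_mem_affineFunctions coordinate))
  exact (hsub hmem).2.comp (continuous_pi fun _ => continuous_id)

end ThresholdNetworks

theorem mainTheorem3 (n : ℕ) (hn : 1 ≤ n) :
    ReLUClass n ⌈Real.logb 2 ((n : ℝ) + 1)⌉₊ = CPWL n ∧
      CPWL n ⊂ PWL n ∧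
      PWL n = SLTClass n 2 := by
  have hdepth : n + 1 ≤ 2 ^ ⌈Real.logb 2 ((n : ℝ) + 1)⌉₊ := by
    have hceil := Nat.le_ceil (Real.logb 2 ((n : ℝ) + 1))
    rw [Real.logb_le_iff_le_rpow one_lt_two (by positivity), Real.rpow_natCast] at hceil
    exact_mod_cast hceil
  exact ⟨ReLUClass_eq_CPWL hdepth, CPWL_ssubset_PWL hn,
    PWL_subset_SLTClass.antisymm SLTClass_succ_subset_PWL⟩
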